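/- Let $\lambda,\beta>0$. Let $N(t)$, $t\ge 0$, be a Poisson process with intensity $\lambda$ (with right-continuous paths having left limits), let $G_1,G_2,\dots$ be i.i.d. exponential random variables with rate $\beta$ (density $\beta e^{-\beta x}$ for $x\ge 0$), independent of the process $N$, and let $E_N(t)=\sum_{n=1}^{N(t)}G_n$ be the compound Poisson process with exponentially distributed jumps with parameters $(\lambda,\beta)$ (equivalently, the subordinator with Laplace exponent $f(u)=\lambda\frac{u}{\beta+u}$). Let $$Y(t)=\inf\{u\ge 0:\ E_N(u)>t\},\qquad t\ge 0,$$ be its inverse (first passage time) process. Then almost surely $Y(t)<\infty$ for all $t\ge 0$, $Y(t)$ is square integrable for every $t\ge 0$, and for all $t,s\ge 0$ $$\mathsf{Cov}\bigl(Y(t),Y(s)\bigr)=\frac{1}{\lambda^{2}}\bigl(2\beta\min(t,s)+1\bigr).$$ -/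

import Mathlib

open MeasureTheory ProbabilityTheory Filter Topology
open scoped NNReal ENNReal

/-- `N` is a Poisson process of intensity `lam`: it starts at `0`, has independent and stationary
increments, `N t` has the Poisson distribution with parameter `lam * t`, and almost all paths are
right-continuous with left limits. Increments are formed in `ℤ`, since subtraction in `ℕ`
truncates. -/
structure IsPoissonProcess {Ω : Type*} [MeasurableSpace Ω] (P : Measure Ω) (lam : ℝ≥0)
    (N : ℝ≥0 → Ω → ℕ) : Prop where
  start_zero : ∀ᵐ ω ∂P, N 0 ω = 0
  indep_increments : HasIndepIncrements (fun t ω => (N t ω : ℤ)) P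
  stationary_increments : ∀ s t : ℝ≥0,
    IdentDistrib (fun ω => (N (s + t) ω : ℤ) - (N s ω : ℤ)) (fun ω => (N t ω : ℤ)) P P
  law : ∀ t : ℝ≥0, HasLaw (N t) (poissonMeasure (lam * t)) P
  cadlag : ∀ᵐ ω ∂P, ∀ t : ℝ≥0,
    ContinuousWithinAt (fun u => N u ω) (Set.Ici t) t ∧
      ∃ l : ℕ, Tendsto (fun u => N u ω) (𝓝[<] t) (𝓝 l)

/-- `E` is a compound Poisson-exponential process with parameters `(lam, beta)`: up to
indistinguishability, `E t` is the sum of the first `N t` terms of a sequence `G 0, G 1, …` of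
i.i.d. exponential variables of rate `beta` (density `beta * exp (- beta * x)` on `x ≥ 0`), where
`N` is a Poisson process of intensity `lam` and the process `N` is independent of the sequence
`G`. -/
def IsCompoundPoissonExponential {Ω : Type*} [MeasurableSpace Ω] (P : Measure Ω)
    (lam beta : ℝ≥0) (E : ℝ≥0 → Ω → ℝ) : Prop :=
  ∃ (N : ℝ≥0 → Ω → ℕ) (G : ℕ → Ω → ℝ),
    IsPoissonProcess P lam N ∧
    (∀ n, HasLaw (G n) (expMeasure (beta : ℝ)) P) ∧
    iIndepFun G P ∧
    IndepFun (fun ω t => N t ω) (fun ω n => G n ω) P ∧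
    ∀ᵐ ω ∂P, ∀ t : ℝ≥0, E t ω = ∑ n ∈ Finset.range (N t ω), G n ω

/-- The inverse (first passage time) process `Y t = inf {u ≥ 0 | E u > t}`, with values in
`[0, ∞]`; the infimum of the empty set is `∞`. -/
noncomputable def inverseProcess {Ω : Type*} (E : ℝ≥0 → Ω → ℝ) (t : ℝ≥0) (ω : Ω) : ℝ≥0∞ :=
  sInf {y : ℝ≥0∞ | ∃ u : ℝ≥0, y = (u : ℝ≥0∞) ∧ (t : ℝ) < E u ω}

/-!
Write `S i` for the sum of the first `i` jumps and `L i` for the time that the Poisson process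
spends at the level `i`. Since paths are nondecreasing, `Y t` is the Lebesgue measure of the set of
times `u` with `E u ≤ t`, and `E u = S i` while `N u = i`, so that almost surely
`Y t = ∑ i, L i * 1_{S i ≤ t}` for all `t` (`ae_inverseProcess_eq_inverseSeries`). The `L i` depend
on the Poisson process only and the `S i` on the jumps only, so the moments of `Y` factor:
`𝔼[Y s * Y t] = ∑ i j, 𝔼[L i * L j] * ℙ(S i ≤ s, S j ≤ t)`, and similarly for `𝔼[Y t]`.

The distribution of the arrival times is not needed, only the moments `𝔼[L i] = 1 / lam` and
`𝔼[L i * L j] = (1 + 1_{i = j}) / lam ^ 2` (`IsPoissonProcess.lintegral_occupationTime_mul`). These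
come from Tonelli's theorem: on `u < v` the probability of `N u = i`, `N v = j` is a product of two
Poisson probabilities, each of integral `1 / lam`. As the process is not assumed jointly
measurable, Tonelli's theorem is applied on the space of paths sampled at rational times, from
which `pathValue` recovers the process.

On the side of the jumps, the Erlang densities sum to the constant `beta` on the half-line
(`sum_gammaMeasure`), which gives `∑ i, ℙ(S i ≤ t) = 1 + beta * t` and, with the independence of
the spacing `S j - S i` from `S i`,
`∑ i j, ℙ(S i ≤ s, S j ≤ t) = (1 + beta * s) * (1 + beta * t) + beta * min s t`
(`tsum_tsum_measure_sum_range_le`).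
-/

/-! ### Gamma distributions with integer shape -/

lemma gammaPDF_succ_of_nonneg (k : ℕ) (r : ℝ) {x : ℝ} (hr : 0 ≤ r) (hx : 0 ≤ x) :
    gammaPDF (k + 1) r x =
      ENNReal.ofReal r * ENNReal.ofReal (Real.exp (-(r * x)) * (r * x) ^ k / k.factorial) := by
  rw [gammaPDF_of_nonneg hx, Real.Gamma_nat_eq_factorial, ← ENNReal.ofReal_mul hr]
  congr 1
  rw [add_sub_cancel_right, Real.rpow_natCast]
  norm_cast
  rw [pow_succ, mul_pow]
  ring

lemma measurable_gammaPDF (a r : ℝ) : Measurable (gammaPDF a r) :=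
  (measurable_gammaPDFReal a r).ennreal_ofReal

lemma gammaMeasure_conv_expMeasure (k : ℕ) {r : ℝ} (hr : 0 < r) :
    gammaMeasure (k + 1) r ∗ expMeasure r = gammaMeasure ((k + 1 : ℕ) + 1) r := by
  unfold expMeasure gammaMeasure
  rw [conv_withDensity_eq_lconvolution (measurable_gammaPDF _ _) (measurable_gammaPDF _ _)]
  congr 1
  ext x
  rw [lconvolution_def]
  rcases lt_or_ge x 0 with hx | hx
  · rw [gammaPDF_of_neg hx]
    refine (lintegral_congr fun y => ?_).trans lintegral_zero
    rcases lt_or_ge y 0 with hy | hy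
    · rw [gammaPDF_of_neg hy, zero_mul]
    · rw [gammaPDF_of_neg (x := -y + x) (by linarith), mul_zero]
  · -- the integrand vanishes off `[0, x]`, and the exponential factors combine to `exp (-r x)`
    have h1 : ∀ y, gammaPDF (k + 1) r y * gammaPDF 1 r (-y + x) =
        (Set.Icc 0 x).indicator (fun y => ENNReal.ofReal
          (r ^ (k + 2) / k.factorial * Real.exp (-(r * x)) * y ^ k)) y := by
      intro y
      by_cases hy : y ∈ Set.Icc 0 x
      · rw [Set.indicator_of_mem hy, gammaPDF_succ_of_nonneg k r hr.le hy.1]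
        have := gammaPDF_succ_of_nonneg 0 r hr.le (x := -y + x) (by linarith [hy.2])
        rw [Nat.cast_zero, zero_add] at this
        have hy0 := hy.1
        rw [this, ← ENNReal.ofReal_mul hr.le, ← ENNReal.ofReal_mul hr.le,
          ← ENNReal.ofReal_mul (by positivity)]
        congr 1
        have he : Real.exp (-(r * x)) = Real.exp (-(r * y)) * Real.exp (-(r * (-y + x))) := by
          rw [← Real.exp_add]; congr 1; ring
        rw [he, mul_pow]
        simp only [pow_zero, Nat.factorial_zero, Nat.cast_one]
        ring
      · rw [Set.indicator_of_notMem hy]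
        simp only [Set.mem_Icc, not_and_or, not_le] at hy
        rcases hy with hy | hy
        · rw [gammaPDF_of_neg hy, zero_mul]
        · rw [gammaPDF_of_neg (x := -y + x) (by linarith), mul_zero]
    simp_rw [h1]
    rw [lintegral_indicator measurableSet_Icc, ← ofReal_integral_eq_lintegral_ofReal,
      integral_Icc_eq_integral_Ioc, ← intervalIntegral.integral_of_le hx,
      intervalIntegral.integral_const_mul, integral_pow,
      gammaPDF_succ_of_nonneg (k + 1) r hr.le hx, ← ENNReal.ofReal_mul hr.le]
    · congr 1
      rw [Nat.factorial_succ, mul_pow]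
      push_cast
      field_simp
      ring
    · exact (Continuous.integrableOn_Icc (by fun_prop))
    · filter_upwards [ae_restrict_mem measurableSet_Icc] with y hy
      have := hy.1
      simp only [Pi.zero_apply]
      positivity

/-- The points of a Poisson process of rate `r` on the half-line have mean measure `r` times
Lebesgue measure: the Erlang densities sum to the constant `r`. -/
lemma sum_gammaMeasure {r : ℝ} (hr : 0 < r) :
    Measure.sum (fun k : ℕ => gammaMeasure (k + 1) r) =
      ENNReal.ofReal r • volume.restrict (Set.Ioi 0) := by
  unfold gammaMeasure
  have hm : Measurable (Set.indicator (Set.Ioi (0 : ℝ)) 1 : ℝ → ℝ≥0∞) :=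
    measurable_one.indicator measurableSet_Ioi
  rw [← withDensity_tsum (fun k => measurable_gammaPDF _ _),
    ← withDensity_indicator_one measurableSet_Ioi, ← withDensity_smul _ hm]
  refine withDensity_congr_ae ?_
  have h0 : ∀ᵐ x : ℝ, x ≠ 0 := by simp [ae_iff]
  filter_upwards [h0] with x hx0
  rw [ENNReal.tsum_apply]
  rcases lt_or_gt_of_ne hx0 with hx | hx
  · simp [gammaPDF_of_neg hx, hx.le]
  · simp_rw [gammaPDF_succ_of_nonneg _ r hr.le hx.le]
    have hs := hasSum_one_poissonMeasure (r * x).toNNReal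
    rw [Real.coe_toNNReal _ (by positivity)] at hs
    rw [ENNReal.tsum_mul_left, ← ENNReal.ofReal_tsum_of_nonneg (fun n => by positivity) hs.summable,
      hs.tsum_eq]
    simp [hx]

lemma tsum_lintegral_gammaMeasure {r : ℝ} (hr : 0 < r) (f : ℝ → ℝ≥0∞) :
    ∑' k : ℕ, ∫⁻ x, f x ∂(gammaMeasure (k + 1) r) =
      ENNReal.ofReal r * ∫⁻ x in Set.Ioi 0, f x := by
  rw [← lintegral_sum_measure, sum_gammaMeasure hr, lintegral_smul_measure, smul_eq_mul]

/-! ### Double series of extended nonnegative numbers -/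

lemma ENNReal.sum_range_add_tsum_nat_add (k : ℕ) (g : ℕ → ℝ≥0∞) :
    ∑ i ∈ Finset.range k, g i + ∑' d, g (d + k) = ∑' i, g i :=
  ENNReal.summable.sum_add_tsum_nat_add' (f := g)

lemma ENNReal.tsum_ite_lt (j : ℕ) (g : ℕ → ℝ≥0∞) :
    ∑' i, (if j < i then g i else 0) = ∑' d, g (j + d + 1) := by
  rw [← ENNReal.sum_range_add_tsum_nat_add (j + 1), Finset.sum_eq_zero, zero_add]
  · refine tsum_congr fun d => ?_
    rw [if_pos (by omega)]
    congr 1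
    omega
  · intro i hi
    rw [if_neg (by have := Finset.mem_range.1 hi; omega)]

/-- A double series splits into its diagonal, upper and lower parts. -/
lemma ENNReal.tsum_tsum_eq_diag_add_upper_add_lower (f : ℕ → ℕ → ℝ≥0∞) :
    ∑' i, ∑' j, f i j =
      ∑' i, f i i + ∑' i, ∑' d, f i (i + d + 1) + ∑' i, ∑' d, f (i + d + 1) i := by
  have h : ∀ i, ∑' j, f i j =
      f i i + ∑' d, f i (i + d + 1) + ∑' j, (if j < i then f i j else 0) := by
    intro i
    rw [← ENNReal.tsum_ite_lt i (f i), ← tsum_ite_eq i (fun j => f i j),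
      ← ENNReal.tsum_add, ← ENNReal.tsum_add]
    refine tsum_congr fun j => ?_
    rcases lt_trichotomy i j with h | rfl | h
    · simp [h, h.not_gt, h.ne']
    · simp
    · simp [h, h.not_gt, h.ne]
  simp_rw [h]
  rw [ENNReal.tsum_add, ENNReal.tsum_add, ENNReal.tsum_comm (f := fun i j => if j < i then f i j else 0)]
  congr 1
  exact tsum_congr fun j => ENNReal.tsum_ite_lt j (fun i => f i j)

/-! ### The renewal process with exponential spacings -/

section Renewal

variable {Ω : Type*} [MeasurableSpace Ω] {P : Measure Ω}
  {beta : ℝ} {G : ℕ → Ω → ℝ}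

lemma hasLaw_sum_range_succ (hbeta : 0 < beta) (hlaw : ∀ n, HasLaw (G n) (expMeasure beta) P)
    (hind : iIndepFun G P) (k : ℕ) :
    HasLaw (fun ω => ∑ n ∈ Finset.range (k + 1), G n ω) (gammaMeasure (k + 1) beta) P := by
  induction k with
  | zero => simpa [expMeasure] using hlaw 0
  | succ k ih =>
    have := isProbabilityMeasure_expMeasure hbeta
    have := isProbabilityMeasure_gammaMeasure (a := (k : ℝ) + 1) (by positivity) hbeta
    have hi : IndepFun (fun ω => ∑ n ∈ Finset.range (k + 1), G n ω) (G (k + 1)) P := by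
      have := hind.indepFun_finsetSum_of_notMem₀ (fun n => (hlaw n).aemeasurable)
        (s := Finset.range (k + 1)) (i := k + 1) (by simp)
      convert this using 2
      simp
    rw [← gammaMeasure_conv_expMeasure k hbeta]
    simp_rw [Finset.sum_range_succ _ (k + 1)]
    exact hi.hasLaw_fun_add ih (hlaw (k + 1))

lemma aemeasurable_sum_range (hlaw : ∀ n, HasLaw (G n) (expMeasure beta) P) (i : ℕ) :
    AEMeasurable (fun ω => ∑ n ∈ Finset.range i, G n ω) P :=
  Finset.aemeasurable_fun_sum _ fun n _ => (hlaw n).aemeasurable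

variable [IsProbabilityMeasure P]

/-- The renewal function: the expected number of `i ≥ 0` whose partial sum `G 0 + ⋯ + G (i - 1)`
is at most `z` is `1 + beta * z` for `z ≥ 0`. -/
lemma tsum_measure_sum_range_le (hbeta : 0 < beta)
    (hlaw : ∀ n, HasLaw (G n) (expMeasure beta) P) (hind : iIndepFun G P) (z : ℝ) :
    ∑' i, P {ω | ∑ n ∈ Finset.range i, G n ω ≤ z} =
      if 0 ≤ z then ENNReal.ofReal (1 + beta * z) else 0 := by
  rw [tsum_eq_zero_add' ENNReal.summable]
  have h : ∀ k : ℕ, P {ω | ∑ n ∈ Finset.range (k + 1), G n ω ≤ z} =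
      ∫⁻ x, (Set.Iic z).indicator 1 x ∂(gammaMeasure (k + 1) beta) := by
    intro k
    rw [lintegral_indicator_one measurableSet_Iic]
    exact (hasLaw_sum_range_succ hbeta hlaw hind k).measure_eq (p := fun x => x ≤ z)
      measurableSet_Iic
  simp_rw [h]
  rw [tsum_lintegral_gammaMeasure hbeta, lintegral_indicator_one measurableSet_Iic,
    Measure.restrict_apply measurableSet_Iic, Set.Iic_inter_Ioi, Real.volume_Ioc, sub_zero]
  split_ifs with hz
  · rw [ENNReal.ofReal_add zero_le_one (by positivity), ENNReal.ofReal_mul hbeta.le]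
    simp [hz]
  · simp [hz, ENNReal.ofReal_of_nonpos (not_le.1 hz).le]

/-- The spacing `G i + ⋯ + G (i + d)` between two partial sums is independent of the earlier one
and has the Erlang distribution of shape `d + 1`. -/
lemma measure_sum_range_le_and_le (hbeta : 0 < beta)
    (hlaw : ∀ n, HasLaw (G n) (expMeasure beta) P) (hind : iIndepFun G P) (i d : ℕ) (s t : ℝ) :
    P {ω | ∑ n ∈ Finset.range i, G n ω ≤ s ∧ ∑ n ∈ Finset.range (i + d + 1), G n ω ≤ t} =
      ∫⁻ y, P {ω | ∑ n ∈ Finset.range i, G n ω ≤ min s (t - y)}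
        ∂(gammaMeasure (d + 1) beta) := by
  have hW : HasLaw (fun ω => ∑ n ∈ Finset.range (d + 1), G (i + n) ω)
      (gammaMeasure (d + 1) beta) P :=
    hasLaw_sum_range_succ (G := fun n => G (i + n)) hbeta (fun n => hlaw _)
      (hind.precomp (add_right_injective i)) d
  have hS := aemeasurable_sum_range hlaw i
  have hi : IndepFun (fun ω => ∑ n ∈ Finset.range (d + 1), G (i + n) ω)
      (fun ω => ∑ n ∈ Finset.range i, G n ω) P := by
    have h := hind.indepFun_finset₀ (Finset.Ico i (i + (d + 1))) (Finset.range i)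
      (by
        rw [Finset.disjoint_left]
        intro a ha hb
        simp only [Finset.mem_Ico, Finset.mem_range] at ha hb
        omega)
      (fun n => (hlaw n).aemeasurable)
    have h2 := h.comp (φ := fun x => ∑ a, x a) (ψ := fun x => ∑ a, x a)
      (by fun_prop) (by fun_prop)
    convert h2 using 1
    · ext ω
      simp only [Function.comp_apply, Finset.univ_eq_attach,
        Finset.sum_attach _ (fun n => G n ω)]
      rw [Finset.sum_Ico_eq_sum_range]
      simp
    · ext ω
      simp only [Function.comp_apply, Finset.univ_eq_attach,
        Finset.sum_attach _ (fun n => G n ω)]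
  have := isProbabilityMeasure_gammaMeasure (a := (d : ℝ) + 1) (by positivity) hbeta
  have hmap := hi.map_prod_eq_prod_map_map hW.aemeasurable hS
  rw [hW.map_eq] at hmap
  have hms : MeasurableSet {p : ℝ × ℝ | p.2 ≤ min s (t - p.1)} :=
    measurableSet_le (by fun_prop) (by fun_prop)
  have key := Measure.map_apply_of_aemeasurable (hW.aemeasurable.prodMk hS) hms
  have := Measure.isProbabilityMeasure_map hS
  rw [hmap, Measure.prod_apply hms] at key
  convert key.symm using 2
  · ext ω
    simp only [add_assoc, Finset.sum_range_add, Set.mem_ofPred_eq, Set.mem_preimage, le_min_iff,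
      le_sub_iff_add_le]
  · ext y
    rw [Measure.map_apply_of_aemeasurable hS (measurable_prodMk_left hms)]
    rfl

lemma integral_min_const {s t : ℝ} (hs : 0 ≤ s) (ht : 0 ≤ t) :
    ∫ y in (0 : ℝ)..t, min s y = min s t * t - min s t ^ 2 / 2 := by
  have hc : Continuous fun y : ℝ => min s y := by fun_prop
  rw [← intervalIntegral.integral_add_adjacent_intervals (b := min s t)
    (hc.intervalIntegrable _ _) (hc.intervalIntegrable _ _)]
  have h1 : ∫ y in (0 : ℝ)..min s t, min s y = ∫ y in (0 : ℝ)..min s t, y := by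
    refine intervalIntegral.integral_congr fun y hy => ?_
    rw [Set.uIcc_of_le (le_min hs ht)] at hy
    exact min_eq_right (hy.2.trans (min_le_left _ _))
  have h2 : ∫ y in min s t..t, min s y = ∫ _ in min s t..t, min s t := by
    refine intervalIntegral.integral_congr fun y hy => ?_
    rw [Set.uIcc_of_le (min_le_right _ _)] at hy
    rcases le_total s t with h | h
    · rw [min_eq_left h] at hy
      simp only [min_eq_left h, min_eq_left hy.1]
    · rw [min_eq_right h] at hy
      rw [le_antisymm hy.2 hy.1]
  rw [h1, h2, intervalIntegral.integral_const, integral_id]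
  simp only [smul_eq_mul]
  ring

/-- Summing over the later index first replaces the law of the spacing by `beta` times Lebesgue
measure, and summing over the earlier one gives the renewal function at `min s (t - y)`. -/
lemma tsum_measure_sum_range_le_and_lt (hbeta : 0 < beta)
    (hlaw : ∀ n, HasLaw (G n) (expMeasure beta) P) (hind : iIndepFun G P) {s t : ℝ}
    (hs : 0 ≤ s) (ht : 0 ≤ t) :
    ∑' i, ∑' d,
      P {ω | ∑ n ∈ Finset.range i, G n ω ≤ s ∧ ∑ n ∈ Finset.range (i + d + 1), G n ω ≤ t} =
      ENNReal.ofReal (beta * t + beta ^ 2 * (min s t * t - min s t ^ 2 / 2)) := by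
  simp_rw [measure_sum_range_le_and_le hbeta hlaw hind, tsum_lintegral_gammaMeasure hbeta]
  have hm : ∀ i : ℕ, Measurable fun y : ℝ =>
      P {ω | ∑ n ∈ Finset.range i, G n ω ≤ min s (t - y)} := by
    intro i
    refine Antitone.measurable fun a b hab => measure_mono fun ω hω => ?_
    simp only [Set.mem_ofPred_eq] at hω ⊢
    exact hω.trans (min_le_min_left _ (by linarith))
  rw [ENNReal.tsum_mul_left, ← lintegral_tsum fun i => (hm i).aemeasurable]
  simp_rw [tsum_measure_sum_range_le hbeta hlaw hind]
  have h1 : ∀ y ∈ Set.Ioi (0 : ℝ), (if 0 ≤ min s (t - y) then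
      ENNReal.ofReal (1 + beta * min s (t - y)) else 0) =
      (Set.Iic t).indicator (fun y => ENNReal.ofReal (1 + beta * min s (t - y))) y := by
    intro y _
    simp [Set.indicator_apply, hs]
  have hc : Continuous fun y => 1 + beta * min s (t - y) := by fun_prop
  rw [setLIntegral_congr_fun measurableSet_Ioi h1, lintegral_indicator measurableSet_Iic,
    Measure.restrict_restrict measurableSet_Iic, Set.Iic_inter_Ioi,
    ← ofReal_integral_eq_lintegral_ofReal (hc.integrableOn_Ioc),
    ← intervalIntegral.integral_of_le ht, ← ENNReal.ofReal_mul hbeta.le,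
    intervalIntegral.integral_add (by simp) ((by fun_prop : Continuous _).intervalIntegrable _ _),
    intervalIntegral.integral_const_mul,
    intervalIntegral.integral_comp_sub_left (fun y => min s y) t, sub_self, sub_zero,
    integral_min_const hs ht]
  · congr 1
    simp
    ring
  · filter_upwards [ae_restrict_mem measurableSet_Ioc] with y hy
    have : 0 ≤ min s (t - y) := le_min hs (by linarith [hy.2])
    simp only [Pi.zero_apply]
    positivity

/-- The mixed second moment of the renewal counts at `s` and `t`, written as a sum of
probabilities over pairs of indices. -/
lemma tsum_tsum_measure_sum_range_le (hbeta : 0 < beta)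
    (hlaw : ∀ n, HasLaw (G n) (expMeasure beta) P) (hind : iIndepFun G P) {s t : ℝ}
    (hs : 0 ≤ s) (ht : 0 ≤ t) :
    ∑' i, ∑' j, P {ω | ∑ n ∈ Finset.range i, G n ω ≤ s ∧ ∑ n ∈ Finset.range j, G n ω ≤ t} =
      ENNReal.ofReal ((1 + beta * s) * (1 + beta * t) + beta * min s t) := by
  have hmin : 0 ≤ min s t := le_min hs ht
  have hst : min s t * max s t = s * t := min_mul_max s t
  have hst' : min s t + max s t = s + t := min_add_max s t
  have hs' : 0 ≤ min s t * s - min s t ^ 2 / 2 := by nlinarith [min_le_left s t]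
  have ht' : 0 ≤ min s t * t - min s t ^ 2 / 2 := by nlinarith [min_le_right s t]
  rw [ENNReal.tsum_tsum_eq_diag_add_upper_add_lower]
  simp_rw [and_comm (a := ∑ n ∈ Finset.range (_ + _ + 1), _ ≤ s)]
  rw [tsum_measure_sum_range_le_and_lt hbeta hlaw hind hs ht,
    tsum_measure_sum_range_le_and_lt hbeta hlaw hind ht hs]
  simp_rw [← le_min_iff]
  rw [tsum_measure_sum_range_le hbeta hlaw hind, if_pos hmin, min_comm t s,
    ← ENNReal.ofReal_add, ← ENNReal.ofReal_add]
  · congr 1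
    linear_combination beta ^ 2 * (hst - min s t * hst')
  all_goals positivity

end Renewal

/-! ### Integer-valued paths sampled at rational times -/

/-- The value at time `u` of the right-continuous monotone path whose values at rational times
are `x`: the infimum of `x` over the rational times after `u`. It is jointly measurable in `x`
and `u`, which the process itself need not be in `ω` and `u`. -/
noncomputable def pathValue (x : ℚ≥0 → ℕ) (u : ℝ) : ℕ := ⨅ q : {q : ℚ≥0 // u < q}, x q

lemma exists_nnrat_gt (u : ℝ) : ∃ q : ℚ≥0, u < q := by
  obtain ⟨n, hn⟩ := exists_nat_gt u
  exact ⟨n, by simpa using hn⟩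

lemma pathValue_le_iff (x : ℚ≥0 → ℕ) (u : ℝ) (k : ℕ) :
    pathValue x u ≤ k ↔ ∃ q : ℚ≥0, u < q ∧ x q ≤ k := by
  have : Nonempty {q : ℚ≥0 // u < q} := by
    obtain ⟨q, hq⟩ := exists_nnrat_gt u
    exact ⟨⟨q, hq⟩⟩
  constructor
  · intro h
    obtain ⟨⟨q, hq⟩, hx⟩ := ciInf_mem fun q : {q : ℚ≥0 // u < q} => x q
    exact ⟨q, hq, hx.le.trans h⟩
  · rintro ⟨q, hq, hx⟩
    exact (ciInf_le (OrderBot.bddBelow _) (⟨q, hq⟩ : {q : ℚ≥0 // u < q})).trans hx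

lemma measurable_pathValue : Measurable fun p : (ℚ≥0 → ℕ) × ℝ => pathValue p.1 p.2 := by
  refine measurable_of_Iic fun k => ?_
  have h : (fun p : (ℚ≥0 → ℕ) × ℝ => pathValue p.1 p.2) ⁻¹' Set.Iic k =
      ⋃ q : ℚ≥0, {p | p.2 < (q : ℝ)} ∩ {p | p.1 q ≤ k} := by
    ext p
    simp [pathValue_le_iff]
  rw [h]
  refine MeasurableSet.iUnion fun q => MeasurableSet.inter ?_ ?_
  · exact measurableSet_lt measurable_snd measurable_const
  · exact measurableSet_le ((measurable_pi_apply q).comp measurable_fst) measurable_const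

lemma exists_nnrat_between {u v : ℝ≥0} (h : u < v) : ∃ q : ℚ≥0, u < q ∧ (q : ℝ≥0) < v := by
  obtain ⟨r, h1, h2⟩ := exists_rat_btwn (NNReal.coe_lt_coe.2 h)
  have h0 : (0 : ℚ) ≤ r := by
    have : (0 : ℝ) ≤ r := u.2.trans h1.le
    exact_mod_cast this
  lift r to ℚ≥0 using h0
  refine ⟨r, ?_, ?_⟩
  · rw [← NNReal.coe_lt_coe]; exact_mod_cast h1
  · rw [← NNReal.coe_lt_coe]; exact_mod_cast h2

lemma exists_nnrat_eq_of_rightContinuous {f : ℝ≥0 → ℕ}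
    (hc : ∀ t, ContinuousWithinAt f (Set.Ici t) t) {u v : ℝ≥0} (h : u < v) :
    ∃ q : ℚ≥0, u < q ∧ (q : ℝ≥0) < v ∧ f q = f u := by
  have h1 : {w | f w = f u} ∈ 𝓝[≥] u := (hc u).eventually_mem (by simp : {f u} ∈ 𝓝 (f u))
  obtain ⟨b, hb, hsub⟩ := (mem_nhdsGE_iff_exists_Ico_subset' h).1 h1
  obtain ⟨q, hq1, hq2⟩ := exists_nnrat_between (lt_min hb h)
  exact ⟨q, hq1, hq2.trans_le (min_le_right _ _), hsub ⟨hq1.le, hq2.trans_le (min_le_left _ _)⟩⟩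

lemma monotone_of_rightContinuous {f : ℝ≥0 → ℕ}
    (hc : ∀ t, ContinuousWithinAt f (Set.Ici t) t) (hq : ∀ p q : ℚ≥0, p ≤ q → f p ≤ f q) :
    Monotone f := by
  intro u v huv
  rcases huv.eq_or_lt with rfl | huv
  · exact le_rfl
  obtain ⟨p, -, hpv, hp⟩ := exists_nnrat_eq_of_rightContinuous hc huv
  obtain ⟨q, hvq, -, hqv⟩ := exists_nnrat_eq_of_rightContinuous hc (lt_add_one v)
  rw [← hp, ← hqv]
  exact hq p q (by exact_mod_cast (hpv.trans hvq).le)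

/-- A right-continuous nondecreasing path is recovered from its values at rational times. -/
lemma pathValue_eq {f : ℝ≥0 → ℕ} (hc : ∀ t, ContinuousWithinAt f (Set.Ici t) t)
    (hm : Monotone f) (u : ℝ≥0) : pathValue (fun q => f q) u = f u := by
  refine le_antisymm ?_ ?_
  · obtain ⟨q, huq, -, hq⟩ := exists_nnrat_eq_of_rightContinuous hc (lt_add_one u)
    exact (pathValue_le_iff _ _ _).2 ⟨q, by exact_mod_cast NNReal.coe_lt_coe.2 huq, hq.le⟩
  · obtain ⟨q, huq, hq⟩ := (pathValue_le_iff (fun q => f q) u _).1 le_rfl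
    refine le_trans (hm ?_) hq
    rw [← NNReal.coe_le_coe]
    exact_mod_cast huq.le

/-! ### Occupation times of the Poisson process -/

/-- The time that a path spends at the level `i`, as a function of its values at rational
times. -/
noncomputable def occupationTime (i : ℕ) (x : ℚ≥0 → ℕ) : ℝ≥0∞ :=
  volume.restrict (Set.Ioi (0 : ℝ)) {u | pathValue x u = i}

lemma measurable_occupationTime (i : ℕ) : Measurable (occupationTime i) :=
  measurable_measure_prodMk_left (measurable_pathValue (measurableSet_singleton i))

/-- As a function of time, `lam` times the probability that a Poisson process of intensity `lam`
is at level `k` is the Erlang density of shape `k + 1`. -/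
lemma lintegral_poissonMeasure_singleton {lam : ℝ≥0} (hlam : 0 < lam) (k : ℕ) :
    ∫⁻ u in Set.Ioi (0 : ℝ), poissonMeasure (lam * u.toNNReal) {k} = (lam : ℝ≥0∞)⁻¹ := by
  have h0 : (lam : ℝ≥0∞) ≠ 0 := by simpa using hlam.ne'
  have hl : (0 : ℝ) < lam := hlam
  have h := lintegral_gammaPDF_eq_one (a := (k : ℝ) + 1) (by positivity) hl
  rw [← lintegral_add_compl _ (measurableSet_Ioi (a := (0 : ℝ))), Set.compl_Ioi,
    setLIntegral_congr Iio_ae_eq_Iic.symm, lintegral_gammaPDF_of_nonpos le_rfl, add_zero,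
    setLIntegral_congr_fun (g := fun u : ℝ =>
      (lam : ℝ≥0∞) * poissonMeasure (lam * u.toNNReal) {k}) measurableSet_Ioi,
    lintegral_const_mul' _ _ ENNReal.coe_ne_top] at h
  · exact ENNReal.eq_inv_of_mul_eq_one_left (by rwa [mul_comm])
  · intro u hu
    have hu' : (0 : ℝ) ≤ u := le_of_lt hu
    simp only [gammaPDF_succ_of_nonneg k _ hl.le hu', poissonMeasure_singleton]
    rw [NNReal.coe_mul, Real.coe_toNNReal _ hu', ENNReal.ofReal_coe_nnreal]

lemma setLIntegral_Ioi_sub (f : ℝ → ℝ≥0∞) (u : ℝ) :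
    ∫⁻ v in Set.Ioi u, f (v - u) = ∫⁻ w in Set.Ioi 0, f w := by
  rw [← lintegral_indicator measurableSet_Ioi, ← lintegral_indicator measurableSet_Ioi,
    ← lintegral_sub_right_eq_self (fun w => (Set.Ioi 0).indicator f w) u]
  refine lintegral_congr fun v => ?_
  simp [Set.indicator_apply]

section Poisson

variable {Ω : Type*} [MeasurableSpace Ω] {P : Measure Ω} {lam : ℝ≥0} {N : ℝ≥0 → Ω → ℕ}

namespace IsPoissonProcess

lemma ae_le (hN : IsPoissonProcess P lam N) {s t : ℝ≥0} (h : s ≤ t) :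
    ∀ᵐ ω ∂P, N s ω ≤ N t ω := by
  have := (hN.stationary_increments s (t - s)).symm.ae_snd (p := fun z : ℤ => 0 ≤ z)
    (MeasurableSet.of_discrete) (by simp)
  filter_upwards [this] with ω hω
  rw [add_tsub_cancel_of_le h] at hω
  omega

/-- Almost every path is right-continuous and nondecreasing. -/
lemma ae_rightContinuous_monotone (hN : IsPoissonProcess P lam N) :
    ∀ᵐ ω ∂P, (∀ t, ContinuousWithinAt (fun u => N u ω) (Set.Ici t) t) ∧
      Monotone fun u => N u ω := by
  have h : ∀ᵐ ω ∂P, ∀ p q : ℚ≥0, p ≤ q → N p ω ≤ N q ω := by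
    rw [ae_all_iff]; intro p
    rw [ae_all_iff]; intro q
    by_cases hpq : p ≤ q
    · filter_upwards [hN.ae_le (s := p) (t := q) (by exact_mod_cast hpq)] with ω hω _ using hω
    · simp [hpq]
  filter_upwards [h, hN.cadlag] with ω h1 h2
  exact ⟨fun t => (h2 t).1, monotone_of_rightContinuous (fun t => (h2 t).1) h1⟩

lemma ae_pathValue_eq (hN : IsPoissonProcess P lam N) :
    ∀ᵐ ω ∂P, ∀ u : ℝ≥0, pathValue (fun q => N q ω) u = N u ω := by
  filter_upwards [hN.ae_rightContinuous_monotone] with ω h u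
  exact pathValue_eq h.1 h.2 u

lemma aemeasurable_rational (hN : IsPoissonProcess P lam N) :
    AEMeasurable (fun ω (q : ℚ≥0) => N q ω) P :=
  aemeasurable_pi_lambda _ fun q => (hN.law q).aemeasurable

lemma measure_eq (hN : IsPoissonProcess P lam N) (u : ℝ≥0) (i : ℕ) :
    P {ω | N u ω = i} = poissonMeasure (lam * u) {i} :=
  (hN.law u).measure_eq (p := fun n => n = i) (measurableSet_singleton i)

lemma measure_eq_and_eq_add (hN : IsPoissonProcess P lam N) {u v : ℝ≥0} (h : u ≤ v) (i d : ℕ) :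
    P {ω | N u ω = i ∧ N v ω = i + d} =
      poissonMeasure (lam * u) {i} * poissonMeasure (lam * (v - u)) {d} := by
  have hi := hN.indep_increments.indepFun_eval_sub zero_le h
    (by simpa using hN.start_zero)
  have h1 := hi.measure_inter_preimage_eq_mul {(i : ℤ)} {(d : ℤ)}
    MeasurableSet.of_discrete MeasurableSet.of_discrete
  have h2 := (hN.stationary_increments u (v - u)).measure_mem_eq (s := {(d : ℤ)})
    MeasurableSet.of_discrete
  rw [add_tsub_cancel_of_le h] at h2
  rw [← hN.measure_eq, ← hN.measure_eq]
  have h3 : {ω | N (v - u) ω = d} = (fun ω => (N (v - u) ω : ℤ)) ⁻¹' {(d : ℤ)} := by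
    ext ω
    simp
  have h4 : {ω | N u ω = i} = (fun ω => (N u ω : ℤ)) ⁻¹' {(i : ℤ)} := by
    ext ω
    simp
  rw [h3, h4, ← h2]
  refine Eq.trans (congrArg P ?_) h1
  ext ω
  simp only [Set.mem_ofPred_eq, Set.mem_inter_iff, Set.mem_preimage, Set.mem_singleton_iff,
    Pi.sub_apply]
  omega

lemma measure_eq_and_eq_of_lt (hN : IsPoissonProcess P lam N) {u v : ℝ≥0} (h : u ≤ v) {i j : ℕ}
    (hij : j < i) : P {ω | N u ω = i ∧ N v ω = j} = 0 := by
  refine measure_mono_null ?_ (ae_iff.1 (hN.ae_le h))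
  intro ω hω
  simp only [Set.mem_ofPred_eq] at hω ⊢
  omega

lemma map_pathValue_eq (hN : IsPoissonProcess P lam N) {u : ℝ} (hu : 0 ≤ u) (i : ℕ) :
    P.map (fun ω (q : ℚ≥0) => N q ω) {x | pathValue x u = i} =
      poissonMeasure (lam * u.toNNReal) {i} := by
  rw [Measure.map_apply_of_aemeasurable hN.aemeasurable_rational, ← hN.measure_eq]
  · refine measure_congr ?_
    filter_upwards [hN.ae_pathValue_eq] with ω h
    have := h u.toNNReal
    rw [Real.coe_toNNReal _ hu] at this
    change (pathValue (fun q => N q ω) u = i) = (N u.toNNReal ω = i)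
    rw [this]
  · exact (measurable_pathValue.comp measurable_prodMk_right) (measurableSet_singleton i)

lemma map_pathValue_eq_and_eq (hN : IsPoissonProcess P lam N) {u v : ℝ} (hu : 0 ≤ u)
    (hv : 0 ≤ v) (i j : ℕ) :
    P.map (fun ω (q : ℚ≥0) => N q ω) {x | pathValue x u = i ∧ pathValue x v = j} =
      P {ω | N u.toNNReal ω = i ∧ N v.toNNReal ω = j} := by
  rw [Measure.map_apply_of_aemeasurable hN.aemeasurable_rational]
  · refine measure_congr ?_
    filter_upwards [hN.ae_pathValue_eq] with ω h
    have h1 := h u.toNNReal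
    have h2 := h v.toNNReal
    rw [Real.coe_toNNReal _ hu] at h1
    rw [Real.coe_toNNReal _ hv] at h2
    change (pathValue (fun q => N q ω) u = i ∧ pathValue (fun q => N q ω) v = j) =
      (N u.toNNReal ω = i ∧ N v.toNNReal ω = j)
    rw [h1, h2]
  · exact (measurable_pathValue.comp measurable_prodMk_right (measurableSet_singleton i)).inter
      (measurable_pathValue.comp measurable_prodMk_right (measurableSet_singleton j))

/-- The mean occupation time of each level is `1 / lam`. -/
lemma lintegral_occupationTime [IsProbabilityMeasure P] (hN : IsPoissonProcess P lam N)
    (hlam : 0 < lam) (i : ℕ) :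
    ∫⁻ ω, occupationTime i (fun q => N q ω) ∂P = (lam : ℝ≥0∞)⁻¹ := by
  have hX := hN.aemeasurable_rational
  have := Measure.isProbabilityMeasure_map hX
  have hs : MeasurableSet {p : (ℚ≥0 → ℕ) × ℝ | pathValue p.1 p.2 = i} :=
    measurable_pathValue (measurableSet_singleton i)
  rw [← lintegral_map' (measurable_occupationTime i).aemeasurable hX]
  refine (Measure.prod_apply hs).symm.trans ?_
  rw [Measure.prod_apply_symm hs, ← lintegral_poissonMeasure_singleton hlam i]
  exact setLIntegral_congr_fun measurableSet_Ioi fun u hu => hN.map_pathValue_eq (le_of_lt hu) i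

/-- The part `u < v` of the mixed second moment of the occupation times of the levels `i` and `j`:
by independence of increments the integrand is a product of two Poisson probabilities, of the
value `i` at time `u` and of the increment `j - i` over the time `v - u`. -/
lemma lintegral_pathValue_eq_and_eq_of_lt (hN : IsPoissonProcess P lam N)
    (hlam : 0 < lam) (i j : ℕ) :
    ∫⁻ u in Set.Ioi (0 : ℝ), ∫⁻ v in Set.Ioi u,
        P.map (fun ω (q : ℚ≥0) => N q ω) {x | pathValue x u = i ∧ pathValue x v = j} =
      if i ≤ j then (lam : ℝ≥0∞)⁻¹ ^ 2 else 0 := by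
  split_ifs with hij
  · obtain ⟨d, rfl⟩ := Nat.exists_eq_add_of_le hij
    have h : ∀ u ∈ Set.Ioi (0 : ℝ), ∫⁻ v in Set.Ioi u,
        P.map (fun ω (q : ℚ≥0) => N q ω) {x | pathValue x u = i ∧ pathValue x v = i + d} =
        poissonMeasure (lam * u.toNNReal) {i} * (lam : ℝ≥0∞)⁻¹ := by
      intro u hu
      have hu' : (0 : ℝ) ≤ u := le_of_lt hu
      rw [← lintegral_poissonMeasure_singleton hlam d, ← setLIntegral_Ioi_sub _ u,
        ← lintegral_const_mul' _ _ (measure_ne_top _ _)]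
      refine setLIntegral_congr_fun measurableSet_Ioi fun v hv => ?_
      have hv' : u ≤ v := le_of_lt hv
      rw [hN.map_pathValue_eq_and_eq hu' (hu'.trans hv'),
        hN.measure_eq_and_eq_add (Real.toNNReal_le_toNNReal hv'), NNReal.sub_def,
        Real.coe_toNNReal _ hu', Real.coe_toNNReal _ (hu'.trans hv')]
    rw [setLIntegral_congr_fun measurableSet_Ioi h, lintegral_mul_const' _ _ (by simp [hlam.ne']),
      lintegral_poissonMeasure_singleton hlam, sq]
  · refine setLIntegral_eq_zero measurableSet_Ioi fun u hu => ?_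
    refine setLIntegral_eq_zero measurableSet_Ioi fun v hv => ?_
    have hu' : (0 : ℝ) ≤ u := le_of_lt hu
    have hv' : u ≤ v := le_of_lt hv
    rw [hN.map_pathValue_eq_and_eq hu' (hu'.trans hv')]
    exact hN.measure_eq_and_eq_of_lt (Real.toNNReal_le_toNNReal hv') (not_le.1 hij)

/-- The mixed second moments of the occupation times are those of independent exponential
variables of rate `lam`. -/
lemma lintegral_occupationTime_mul [IsProbabilityMeasure P] (hN : IsPoissonProcess P lam N)
    (hlam : 0 < lam) (i j : ℕ) :
    ∫⁻ ω, occupationTime i (fun q => N q ω) * occupationTime j (fun q => N q ω) ∂P =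
      (lam : ℝ≥0∞)⁻¹ ^ 2 * if i = j then 2 else 1 := by
  have hX := hN.aemeasurable_rational
  have := Measure.isProbabilityMeasure_map hX
  have hsk : ∀ k : ℕ, MeasurableSet {p : (ℚ≥0 → ℕ) × ℝ | pathValue p.1 p.2 = k} :=
    fun k => measurable_pathValue (measurableSet_singleton k)
  have hs : MeasurableSet {p : (ℚ≥0 → ℕ) × ℝ × ℝ |
      pathValue p.1 p.2.1 = i ∧ pathValue p.1 p.2.2 = j} :=
    ((hsk i).preimage (f := fun p : (ℚ≥0 → ℕ) × ℝ × ℝ => (p.1, p.2.1)) (by fun_prop)).inter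
      ((hsk j).preimage (f := fun p : (ℚ≥0 → ℕ) × ℝ × ℝ => (p.1, p.2.2)) (by fun_prop))
  rw [← lintegral_map' (f := fun x => occupationTime i x * occupationTime j x)
    ((measurable_occupationTime i).mul (measurable_occupationTime j)).aemeasurable hX]
  -- Tonelli, with the product of the two occupation times read as an area
  have h1 : ∀ x, occupationTime i x * occupationTime j x =
      ((volume.restrict (Set.Ioi (0 : ℝ))).prod (volume.restrict (Set.Ioi (0 : ℝ))))
        (Prod.mk x ⁻¹' {p : (ℚ≥0 → ℕ) × ℝ × ℝ |
          pathValue p.1 p.2.1 = i ∧ pathValue p.1 p.2.2 = j}) := by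
    intro x
    rw [occupationTime, occupationTime, ← Measure.prod_prod]
    rfl
  simp_rw [h1]
  rw [← Measure.prod_apply hs, Measure.prod_apply_symm hs]
  have hm := measurable_measure_prodMk_right (μ := P.map (fun ω (q : ℚ≥0) => N q ω)) hs
  rw [lintegral_prod _ hm.aemeasurable]
  set F : ℝ × ℝ → ℝ≥0∞ := fun p => P.map (fun ω (q : ℚ≥0) => N q ω) ((fun x => (x, p)) ⁻¹'
    {p : (ℚ≥0 → ℕ) × ℝ × ℝ | pathValue p.1 p.2.1 = i ∧ pathValue p.1 p.2.2 = j}) with hF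
  have hK := hm.indicator (measurableSet_lt measurable_snd measurable_fst :
    MeasurableSet {p : ℝ × ℝ | p.2 < p.1})
  -- split the quadrant along its diagonal
  have h2 : ∀ u ∈ Set.Ioi (0 : ℝ), ∫⁻ v in Set.Ioi (0 : ℝ), F (u, v) =
      (∫⁻ v in Set.Ioi u, F (u, v)) +
        ∫⁻ v in Set.Ioi (0 : ℝ), {p : ℝ × ℝ | p.2 < p.1}.indicator F (u, v) := by
    intro u hu
    have h3 : ∀ v, {p : ℝ × ℝ | p.2 < p.1}.indicator F (u, v) =
        (Set.Iio u).indicator (fun v => F (u, v)) v := fun v => by simp [Set.indicator_apply]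
    simp_rw [h3]
    rw [← lintegral_inter_add_sdiff (fun v => F (u, v)) (Set.Ioi (0 : ℝ))
        (measurableSet_Ioi (a := u)),
      lintegral_indicator measurableSet_Iio, Measure.restrict_restrict measurableSet_Iio,
      Set.inter_eq_right.2 (Set.Ioi_subset_Ioi (le_of_lt (Set.mem_Ioi.1 hu))),
      Set.Ioi_sdiff_Ioi, Set.inter_comm, Set.Ioi_inter_Iio, setLIntegral_congr Ioo_ae_eq_Ioc]
  rw [setLIntegral_congr_fun measurableSet_Ioi h2,
    lintegral_add_right _ (hK.lintegral_prod_right' (ν := volume.restrict (Set.Ioi (0 : ℝ))))]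
  have hswap := lintegral_lintegral_swap (μ := volume.restrict (Set.Ioi (0 : ℝ)))
    (ν := volume.restrict (Set.Ioi (0 : ℝ)))
    (f := fun u v => {p : ℝ × ℝ | p.2 < p.1}.indicator F (u, v)) hK.aemeasurable
  refine (congrArg₂ (· + ·) (hN.lintegral_pathValue_eq_and_eq_of_lt hlam i j) (hswap.trans ?_)).trans
    (b := (if i ≤ j then (lam : ℝ≥0∞)⁻¹ ^ 2 else 0) + if j ≤ i then (lam : ℝ≥0∞)⁻¹ ^ 2 else 0) ?_
  · rw [← hN.lintegral_pathValue_eq_and_eq_of_lt hlam j i]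
    refine setLIntegral_congr_fun measurableSet_Ioi fun v hv => ?_
    have h3 : ∀ u, {p : ℝ × ℝ | p.2 < p.1}.indicator F (u, v) =
        (Set.Ioi v).indicator (fun u => P.map (fun ω (q : ℚ≥0) => N q ω)
          {x | pathValue x v = j ∧ pathValue x u = i}) u := by
      intro u
      by_cases huv : v < u
      · rw [Set.indicator_of_mem (by exact huv), Set.indicator_of_mem (by exact huv)]
        refine congrArg (P.map fun ω (q : ℚ≥0) => N q ω) ?_
        ext x
        exact and_comm
      · rw [Set.indicator_of_notMem (by exact huv), Set.indicator_of_notMem (by exact huv)]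
    simp_rw [h3]
    rw [lintegral_indicator measurableSet_Ioi, Measure.restrict_restrict measurableSet_Ioi,
      Set.inter_eq_left.2 (Set.Ioi_subset_Ioi (le_of_lt (Set.mem_Ioi.1 hv)))]
  · rcases lt_trichotomy i j with h | rfl | h
    · simp [h.le, h.ne, h.not_ge]
    · simp [mul_two]
    · simp [h.le, h.ne', h.not_ge]

end IsPoissonProcess
end Poisson

/-! ### The inverse process as a sum of occupation times -/

lemma inverseProcess_mono {Ω : Type*} (E : ℝ≥0 → Ω → ℝ) (ω : Ω) :
    Monotone fun t => inverseProcess E t ω := by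
  intro s t hst
  refine sInf_le_sInf ?_
  rintro y ⟨u, rfl, hu⟩
  exact ⟨u, rfl, lt_of_le_of_lt (by exact_mod_cast hst) hu⟩

/-- For a nondecreasing path, the first passage time over `t` is the time spent at or below
`t`. -/
lemma inverseProcess_eq_volume {Ω : Type*} {E : ℝ≥0 → Ω → ℝ} {ω : Ω}
    (hE : Monotone fun u => E u ω) (t : ℝ≥0) :
    inverseProcess E t ω = volume.restrict (Set.Ioi (0 : ℝ)) {u | E u.toNNReal ω ≤ t} := by
  have hle : ∀ u : ℝ≥0, (u : ℝ≥0∞) < inverseProcess E t ω → E u ω ≤ t := by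
    intro u hu
    by_contra h
    refine absurd ?_ (not_le.2 hu)
    exact sInf_le ⟨u, rfl, not_le.1 h⟩
  have hge : ∀ u : ℝ≥0, inverseProcess E t ω < u → (t : ℝ) < E u ω := by
    intro u hu
    obtain ⟨_, ⟨a, rfl, ha⟩, hau⟩ := sInf_lt_iff.1 hu
    exact ha.trans_le (hE (by exact_mod_cast hau.le))
  rw [Measure.restrict_apply' measurableSet_Ioi]
  induction hy : inverseProcess E t ω with
  | top =>
    have : {u : ℝ | E u.toNNReal ω ≤ t} ∩ Set.Ioi 0 = Set.Ioi 0 :=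
      Set.inter_eq_right.2 fun u _ => hle _ (by simp [hy])
    rw [this, Real.volume_Ioi]
  | coe b =>
    rw [hy] at hle hge
    refine le_antisymm ?_ ?_
    · calc (b : ℝ≥0∞) = volume (Set.Ioo (0 : ℝ) b) := by simp
        _ ≤ _ := by
          refine measure_mono fun u hu => ⟨hle _ ?_, hu.1⟩
          rw [ENNReal.coe_lt_coe, Real.toNNReal_lt_iff_lt_coe hu.1.le]
          exact hu.2
    · calc _ ≤ volume (Set.Ioc (0 : ℝ) b) := by
            refine measure_mono fun u hu => ⟨hu.2, ?_⟩
            by_contra h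
            refine absurd hu.1 (not_le.2 (hge _ ?_))
            rw [ENNReal.coe_lt_coe, Real.lt_toNNReal_iff_coe_lt]
            exact not_le.1 h
        _ = b := by simp

lemma volume_pathValue_mem (x : ℚ≥0 → ℕ) (A : ℕ → Prop) [DecidablePred A] :
    volume.restrict (Set.Ioi (0 : ℝ)) {u | A (pathValue x u)} =
      ∑' i, occupationTime i x * if A i then 1 else 0 := by
  have hx : Measurable (pathValue x) := measurable_pathValue.comp measurable_prodMk_left
  have h : {u | A (pathValue x u)} = ⋃ i, {u | pathValue x u = i ∧ A i} := by
    ext u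
    simp
  rw [h, measure_iUnion]
  · refine tsum_congr fun i => ?_
    by_cases hi : A i <;> simp [hi, occupationTime]
  · intro i j hij
    refine Set.disjoint_left.2 fun u hi hj => hij ?_
    exact hi.1.symm.trans hj.1
  · intro i
    exact (hx (measurableSet_singleton i)).inter (MeasurableSet.const _)

/-- The inverse process as a sum of occupation times, in which the Poisson process and the jumps
are separated. -/
noncomputable def inverseSeries {Ω : Type*} (N : ℝ≥0 → Ω → ℕ) (G : ℕ → Ω → ℝ) (t : ℝ≥0)
    (ω : Ω) : ℝ≥0∞ :=
  ∑' i, occupationTime i (fun q => N q ω) *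
    if ∑ n ∈ Finset.range i, G n ω ≤ t then 1 else 0

section Assembly

variable {Ω : Type*} [MeasurableSpace Ω] {P : Measure Ω}
  {lam : ℝ≥0} {beta : ℝ} {E : ℝ≥0 → Ω → ℝ} {N : ℝ≥0 → Ω → ℕ} {G : ℕ → Ω → ℝ}

lemma ae_nonneg_of_hasLaw_expMeasure {X : Ω → ℝ} (hX : HasLaw X (expMeasure beta) P) :
    ∀ᵐ ω ∂P, 0 ≤ X ω := by
  refine (hX.ae_iff (p := fun x => 0 ≤ x) (measurableSet_Ici.mem)).2 ?_
  rw [ae_iff]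
  have h : {x : ℝ | ¬ 0 ≤ x} = Set.Iio 0 := by ext; simp
  rw [h, expMeasure, gammaMeasure, withDensity_apply _ measurableSet_Iio]
  exact lintegral_gammaPDF_of_nonpos le_rfl

lemma ae_inverseProcess_eq_inverseSeries (hN : IsPoissonProcess P lam N)
    (hlaw : ∀ n, HasLaw (G n) (expMeasure beta) P)
    (hE : ∀ᵐ ω ∂P, ∀ t : ℝ≥0, E t ω = ∑ n ∈ Finset.range (N t ω), G n ω) :
    ∀ᵐ ω ∂P, ∀ t, inverseProcess E t ω = inverseSeries N G t ω := by
  have hG : ∀ᵐ ω ∂P, ∀ n, 0 ≤ G n ω :=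
    ae_all_iff.2 fun n => ae_nonneg_of_hasLaw_expMeasure (hlaw n)
  filter_upwards [hE, hG, hN.ae_rightContinuous_monotone, hN.ae_pathValue_eq] with ω h1 h2 h3 h4 t
  have hm : Monotone fun u => E u ω := by
    intro u v huv
    simp only [h1]
    exact Finset.sum_le_sum_of_subset_of_nonneg
      (Finset.range_subset_range.2 (h3.2 huv)) fun n _ _ => h2 n
  rw [inverseProcess_eq_volume hm, inverseSeries,
    ← volume_pathValue_mem _ fun i => ∑ n ∈ Finset.range i, G n ω ≤ t]
  refine measure_congr ?_
  filter_upwards [ae_restrict_mem measurableSet_Ioi] with u hu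
  have h5 := h4 u.toNNReal
  rw [Real.coe_toNNReal _ (le_of_lt hu)] at h5
  change (E u.toNNReal ω ≤ t) =
    (∑ n ∈ Finset.range (pathValue (fun q => N q ω) u), G n ω ≤ t)
  rw [h5, h1]

lemma aemeasurable_mul_ite_paths (hN : IsPoissonProcess P lam N)
    (hG : ∀ n, AEMeasurable (G n) P) {φ : (ℚ≥0 → ℕ) → ℝ≥0∞} (hφ : Measurable φ)
    {A : (ℕ → ℝ) → Prop} [DecidablePred A] (hA : MeasurableSet {g | A g}) :
    AEMeasurable
      (fun ω => φ (fun q => N q ω) * if A (fun n => G n ω) then (1 : ℝ≥0∞) else 0) P :=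
  (hφ.comp_aemeasurable hN.aemeasurable_rational).mul
    ((Measurable.ite hA measurable_const measurable_const :
      Measurable fun g => if A g then (1 : ℝ≥0∞) else 0).comp_aemeasurable
        (aemeasurable_pi_lambda _ hG))

/-- A functional of the Poisson path and an event of the jumps are independent. -/
lemma lintegral_mul_ite_of_indepFun_paths (hN : IsPoissonProcess P lam N)
    (hG : ∀ n, AEMeasurable (G n) P)
    (hNG : IndepFun (fun ω t => N t ω) (fun ω n => G n ω) P)
    {φ : (ℚ≥0 → ℕ) → ℝ≥0∞} (hφ : Measurable φ)
    {A : (ℕ → ℝ) → Prop} [DecidablePred A] (hA : MeasurableSet {g | A g}) :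
    ∫⁻ ω, φ (fun q => N q ω) * (if A (fun n => G n ω) then 1 else 0) ∂P =
      (∫⁻ ω, φ (fun q => N q ω) ∂P) * P {ω | A (fun n => G n ω)} := by
  have hψ : Measurable fun g => if A g then (1 : ℝ≥0∞) else 0 :=
    Measurable.ite hA measurable_const measurable_const
  have hG' : AEMeasurable (fun ω n => G n ω) P := aemeasurable_pi_lambda _ hG
  have hP : P {ω | A (fun n => G n ω)} = ∫⁻ ω, (if A (fun n => G n ω) then 1 else 0) ∂P := by
    refine (lintegral_indicator_one₀ (s := {ω | A (fun n => G n ω)})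
      (hG'.nullMeasurableSet_preimage hA)).symm.trans (lintegral_congr fun ω => ?_)
    simp [Set.indicator_apply]
  rw [hP]
  refine lintegral_mul_eq_lintegral_mul_lintegral_of_indepFun''
    (hφ.comp_aemeasurable hN.aemeasurable_rational) (hψ.comp_aemeasurable hG') ?_
  refine hNG.comp (φ := fun x : ℝ≥0 → ℕ => φ fun q : ℚ≥0 => x q) ?_ hψ
  exact hφ.comp (measurable_pi_lambda _ fun q => measurable_pi_apply _)

lemma measurableSet_sum_range_le (i : ℕ) (t : ℝ) :
    MeasurableSet {g : ℕ → ℝ | ∑ n ∈ Finset.range i, g n ≤ t} :=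
  measurableSet_le (by fun_prop) measurable_const

lemma aemeasurable_inverseSeries (hN : IsPoissonProcess P lam N)
    (hlaw : ∀ n, HasLaw (G n) (expMeasure beta) P) (t : ℝ≥0) :
    AEMeasurable (inverseSeries N G t) P :=
  AEMeasurable.tsum fun i => aemeasurable_mul_ite_paths hN (fun n => (hlaw n).aemeasurable)
    (measurable_occupationTime i) (measurableSet_sum_range_le i t)

variable [IsProbabilityMeasure P]

/-- The mean of the inverse process: the mean `1 / lam` of an occupation time multiplied by the
renewal function of the jumps. -/
lemma lintegral_inverseSeries (hlam : 0 < lam) (hbeta : 0 < beta) (hN : IsPoissonProcess P lam N)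
    (hlaw : ∀ n, HasLaw (G n) (expMeasure beta) P) (hind : iIndepFun G P)
    (hNG : IndepFun (fun ω t => N t ω) (fun ω n => G n ω) P) (t : ℝ≥0) :
    ∫⁻ ω, inverseSeries N G t ω ∂P = (lam : ℝ≥0∞)⁻¹ * ENNReal.ofReal (1 + beta * t) := by
  have hG := fun n => (hlaw n).aemeasurable
  have hi : ∀ i, ∫⁻ ω, occupationTime i (fun q => N q ω) *
      (if ∑ n ∈ Finset.range i, G n ω ≤ t then 1 else 0) ∂P =
      (lam : ℝ≥0∞)⁻¹ * P {ω | ∑ n ∈ Finset.range i, G n ω ≤ t} := fun i =>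
    (lintegral_mul_ite_of_indepFun_paths hN hG hNG (measurable_occupationTime i)
      (measurableSet_sum_range_le i t)).trans
        (congrArg (· * _) (hN.lintegral_occupationTime hlam i))
  refine (lintegral_tsum fun i => aemeasurable_mul_ite_paths hN hG (measurable_occupationTime i)
    (measurableSet_sum_range_le i t)).trans ?_
  simp_rw [hi]
  rw [ENNReal.tsum_mul_left, tsum_measure_sum_range_le hbeta hlaw hind, if_pos t.coe_nonneg]

/-- The mixed second moment of the inverse process. The factor `2` in front of `beta * min s t`
and the final `1` collect two diagonal terms, one from the second moments of the occupation times
and one from pairs of equal indices among the partial sums of the jumps. -/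
lemma lintegral_inverseSeries_mul (hlam : 0 < lam) (hbeta : 0 < beta)
    (hN : IsPoissonProcess P lam N)
    (hlaw : ∀ n, HasLaw (G n) (expMeasure beta) P) (hind : iIndepFun G P)
    (hNG : IndepFun (fun ω t => N t ω) (fun ω n => G n ω) P) (s t : ℝ≥0) :
    ∫⁻ ω, inverseSeries N G s ω * inverseSeries N G t ω ∂P =
      (lam : ℝ≥0∞)⁻¹ ^ 2 * ENNReal.ofReal
        ((1 + beta * s) * (1 + beta * t) + 2 * beta * min (s : ℝ) t + 1) := by
  have hG := fun n => (hlaw n).aemeasurable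
  have hms : ∀ i j, MeasurableSet
      {g : ℕ → ℝ | ∑ n ∈ Finset.range i, g n ≤ s ∧ ∑ n ∈ Finset.range j, g n ≤ t} := fun i j =>
    (measurableSet_sum_range_le i s).inter (measurableSet_sum_range_le j t)
  have hφ : ∀ i j, Measurable fun x => occupationTime i x * occupationTime j x := fun i j =>
    (measurable_occupationTime i).mul (measurable_occupationTime j)
  set p : ℕ → ℕ → ℝ≥0∞ := fun i j =>
    P {ω | ∑ n ∈ Finset.range i, G n ω ≤ s ∧ ∑ n ∈ Finset.range j, G n ω ≤ t} with hp
  have hexp : ∀ ω, inverseSeries N G s ω * inverseSeries N G t ω = ∑' i, ∑' j,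
      (occupationTime i (fun q => N q ω) * occupationTime j (fun q => N q ω)) *
        if ∑ n ∈ Finset.range i, G n ω ≤ s ∧ ∑ n ∈ Finset.range j, G n ω ≤ t then 1 else 0 := by
    intro ω
    simp only [inverseSeries]
    rw [← ENNReal.tsum_mul_right]
    refine tsum_congr fun i => ?_
    rw [← ENNReal.tsum_mul_left]
    refine tsum_congr fun j => ?_
    by_cases h1 : ∑ n ∈ Finset.range i, G n ω ≤ s <;>
      by_cases h2 : ∑ n ∈ Finset.range j, G n ω ≤ t <;> simp [h1, h2]
  have hij : ∀ i j, ∫⁻ ω,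
      (occupationTime i (fun q => N q ω) * occupationTime j (fun q => N q ω)) *
        (if ∑ n ∈ Finset.range i, G n ω ≤ s ∧ ∑ n ∈ Finset.range j, G n ω ≤ t
          then 1 else 0) ∂P =
      (lam : ℝ≥0∞)⁻¹ ^ 2 * (p i j + if j = i then p i j else 0) := by
    intro i j
    refine (lintegral_mul_ite_of_indepFun_paths hN hG hNG (hφ i j) (hms i j)).trans ?_
    rw [hN.lintegral_occupationTime_mul hlam, mul_assoc]
    congr 1
    change (if i = j then 2 else 1) * p i j = _
    rcases eq_or_ne i j with rfl | hne
    · simp [two_mul]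
    · simp [hne, hne.symm]
  have hmeas : ∀ i j, AEMeasurable (fun ω =>
      (occupationTime i (fun q => N q ω) * occupationTime j (fun q => N q ω)) *
        if ∑ n ∈ Finset.range i, G n ω ≤ s ∧ ∑ n ∈ Finset.range j, G n ω ≤ t
          then (1 : ℝ≥0∞) else 0) P := fun i j =>
    aemeasurable_mul_ite_paths hN hG (hφ i j) (hms i j)
  simp_rw [hexp]
  rw [lintegral_tsum fun i => AEMeasurable.tsum (hmeas i)]
  simp_rw [lintegral_tsum (hmeas _), hij, ENNReal.tsum_mul_left, ENNReal.tsum_add, tsum_ite_eq]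
  have hmin : (0 : ℝ) ≤ min (s : ℝ) t := le_min s.2 t.2
  have hdiag : ∑' i, p i i = ENNReal.ofReal (1 + beta * min (s : ℝ) t) := by
    simp_rw [hp, ← le_min_iff]
    rw [tsum_measure_sum_range_le hbeta hlaw hind, if_pos hmin]
  have hall : ∑' i, ∑' j, p i j = _ :=
    tsum_tsum_measure_sum_range_le hbeta hlaw hind s.coe_nonneg t.coe_nonneg
  rw [hdiag, hall, ← ENNReal.ofReal_add]
  · congr 2
    ring
  all_goals positivity

end Assembly

theorem lemma1 {Ω : Type*} [MeasurableSpace Ω] (P : Measure Ω) [IsProbabilityMeasure P]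
    (lam beta : ℝ≥0) (hlam : 0 < lam) (hbeta : 0 < beta)
    (E : ℝ≥0 → Ω → ℝ) (hE : IsCompoundPoissonExponential P lam beta E) :
    (∀ᵐ ω ∂P, ∀ t : ℝ≥0, inverseProcess E t ω < ∞) ∧
    (∀ t : ℝ≥0, MemLp (fun ω => (inverseProcess E t ω).toReal) 2 P) ∧
    ∀ t s : ℝ≥0,
      covariance (fun ω => (inverseProcess E t ω).toReal)
          (fun ω => (inverseProcess E s ω).toReal) P =
        1 / (lam : ℝ) ^ 2 * (2 * (beta : ℝ) * min (t : ℝ) (s : ℝ) + 1) := by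
  obtain ⟨N, G, hN, hlaw, hind, hNG, hE⟩ := hE
  have hb : (0 : ℝ) < beta := hbeta
  have hli : (lam : ℝ≥0∞)⁻¹ ≠ ∞ := by simp [hlam.ne']
  have hY := ae_inverseProcess_eq_inverseSeries hN hlaw hE
  have hYt : ∀ t, inverseProcess E t =ᵐ[P] inverseSeries N G t := fun t => by
    filter_upwards [hY] with ω h using h t
  have hmeas : ∀ t, AEMeasurable (inverseProcess E t) P := fun t =>
    (aemeasurable_inverseSeries hN hlaw t).congr (hYt t).symm
  have h1 : ∀ t, ∫⁻ ω, inverseProcess E t ω ∂P =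
      (lam : ℝ≥0∞)⁻¹ * ENNReal.ofReal (1 + beta * t) := fun t =>
    (lintegral_congr_ae (hYt t)).trans
      (lintegral_inverseSeries hlam hb hN hlaw hind hNG t)
  have h2 : ∀ s t, ∫⁻ ω, inverseProcess E s ω * inverseProcess E t ω ∂P =
      (lam : ℝ≥0∞)⁻¹ ^ 2 * ENNReal.ofReal
        ((1 + beta * s) * (1 + beta * t) + 2 * beta * min (s : ℝ) t + 1) := fun s t =>
    (lintegral_congr_ae ((hYt s).mul (hYt t))).trans
      (lintegral_inverseSeries_mul hlam hb hN hlaw hind hNG s t)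
  have hfin : ∀ t, ∀ᵐ ω ∂P, inverseProcess E t ω < ∞ := fun t =>
    ae_lt_top' (hmeas t) (by rw [h1]; exact ENNReal.mul_ne_top hli ENNReal.ofReal_ne_top)
  have hfin2 : ∀ s t, ∫⁻ ω, inverseProcess E s ω * inverseProcess E t ω ∂P ≠ ∞ := fun s t => by
    rw [h2]; exact ENNReal.mul_ne_top (ENNReal.pow_ne_top hli) ENNReal.ofReal_ne_top
  have hL2 : ∀ t : ℝ≥0, MemLp (fun ω => (inverseProcess E t ω).toReal) 2 P := by
    intro t
    rw [memLp_two_iff_integrable_sq (hmeas t).ennreal_toReal.aestronglyMeasurable]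
    simp_rw [sq, ← ENNReal.toReal_mul]
    exact integrable_toReal_of_lintegral_ne_top ((hmeas t).mul (hmeas t)) (hfin2 t t)
  refine ⟨?_, hL2, fun t s => ?_⟩
  · filter_upwards [ae_all_iff.2 fun n : ℕ => hfin n] with ω hω t
    obtain ⟨n, hn⟩ := exists_nat_ge t
    exact (inverseProcess_mono E ω hn).trans_lt (hω n)
  · have e1 : ∀ t, ∫ ω, (inverseProcess E t ω).toReal ∂P = (lam : ℝ)⁻¹ * (1 + beta * t) := by
      intro t
      rw [integral_toReal (hmeas t) (hfin t), h1, ENNReal.toReal_mul,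
        ENNReal.toReal_ofReal (by positivity), ENNReal.toReal_inv, ENNReal.coe_toReal]
    have e2 : ∫ ω, (inverseProcess E t ω).toReal * (inverseProcess E s ω).toReal ∂P =
        (lam : ℝ)⁻¹ ^ 2 *
          ((1 + beta * t) * (1 + beta * s) + 2 * beta * min (t : ℝ) s + 1) := by
      have hmin : (0 : ℝ) ≤ min (t : ℝ) s := le_min t.2 s.2
      simp_rw [← ENNReal.toReal_mul]
      rw [integral_toReal (μ := P) (f := fun ω => inverseProcess E t ω * inverseProcess E s ω)
        ((hmeas t).mul (hmeas s)), h2, ENNReal.toReal_mul,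
        ENNReal.toReal_ofReal (by positivity), ENNReal.toReal_pow, ENNReal.toReal_inv,
        ENNReal.coe_toReal]
      filter_upwards [hfin t, hfin s] with ω ht hs using ENNReal.mul_lt_top ht hs
    rw [covariance_eq_sub (hL2 t) (hL2 s), e1, e1]
    refine (congrArg (· - _) e2).trans ?_
    field_simp
    ring
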